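/- Let $d\ge 0$ and $\ell\ge 1$ be integers, let $X\subset\mathbb R^d$ be a nonempty closed set, and let $\{S_i\}_{i=1}^{\ell}$ be an iterated function system (IFS) of injective maps on $X$: each $S_i:X\to X$ is injective and is a contraction, i.e. $|S_i(x)-S_i(y)|\le c_i|x-y|$ for all $x,y\in X$ with some $c_i<1$. Let $K\subset X$ be its attractor, the unique nonempty compact set with $K=\bigcup_{i=1}^{\ell}S_i(K)$. For a word $u=u_1\cdots u_n\in\{1,\dots,\ell\}^n$ write $S_u=S_{u_1}\circ\cdots\circ S_{u_n}:X\to X$. Let $\Sigma=\{1,\dots,\ell\}^{\mathbb N}$ with the product topology and the left shift $\sigma$, and let $\pi:\Sigma\to K$ be the canonical projection, $\{\pi(x)\}=\bigcap_{n\ge1}S_{x_1}\circ\cdots\circ S_{x_n}(K)$. Let $\mathcal M_\sigma(\Sigma)$ be the set of $\sigma$-invariant Borel probability measures on $\Sigma$ with the weak-star topology. Let $\mathcal P=\{[j]:1\le j\le \ell\}$ with $[j]=\{x\in\Sigma: x_1=j\}$, and let $\gamma$ be the Borel $\sigma$-algebra of $\mathbb R^d$. For $m\in\mathcal M_\sigma(\Sigma)$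 and a sub-$\sigma$-algebra $\mathcal A$ of the Borel $\sigma$-algebra of $\Sigma$ put $$H_m(\mathcal P|\mathcal A)=-\int\sum_{A\in\mathcal P}\chi_A\log \mathbf E_m(\chi_A|\mathcal A)\,dm ,$$ and define the projection entropy $$h_\pi(\sigma,m)=H_m(\mathcal P|\sigma^{-1}\pi^{-1}\gamma)-H_m(\mathcal P|\pi^{-1}\gamma).$$ Assume that the IFS satisfies the asymptotically weak separation condition (AWSC): $$\lim_{n\to\infty}\frac1n\log t_n=0,\qquad t_n=\sup_{x\in\mathbb R^d}\#\{S_u:\ u\in\{1,\dots,\ell\}^n,\ x\in S_u(K)\},$$ where distinct maps $S_u$ are counted. Then $m\mapsto h_\pi(\sigma,m)$ is upper semicontinuous on $\mathcal M_\sigma(\Sigma)$. -/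

import Mathlib

open MeasureTheory Filter Topology
open scoped NNReal ENNReal

/-- An iterated function system: finitely many contractions of a nonempty closed subset `X` of
Euclidean space `ℝ^d` into itself, indexed by `Fin ℓ`. -/
structure IFS (d ℓ : ℕ) where
  X : Set (EuclideanSpace ℝ (Fin d))
  isClosed_X : IsClosed X
  nonempty_X : X.Nonempty
  map : Fin ℓ → X → X
  contracting : ∀ i, ∃ c : ℝ≥0, ContractingWith c (map i)

namespace IFS

variable {d ℓ : ℕ}

theorem exists_ratio (Φ : IFS d ℓ) : ∃ c : ℝ≥0, c < 1 ∧ ∀ i, LipschitzWith c (Φ.map i) := by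
  choose c hc using Φ.contracting
  refine ⟨Finset.univ.sup c, ?_, fun i => (hc i).2.weaken (Finset.le_sup (Finset.mem_univ i))⟩
  rw [Finset.sup_lt_iff (by simp)]
  exact fun i _ => (hc i).1

/-- The composition `S_{u_1} ∘ ⋯ ∘ S_{u_n}` along a word `u` of length `n`. -/
def wordMap (Φ : IFS d ℓ) : (n : ℕ) → (Fin n → Fin ℓ) → Φ.X → Φ.X
  | 0, _ => id
  | n + 1, u => Φ.map (u 0) ∘ Φ.wordMap n (fun i => u i.succ)

theorem lipschitzWith_wordMap (Φ : IFS d ℓ) {c : ℝ≥0} (hc : ∀ i, LipschitzWith c (Φ.map i))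
    (n : ℕ) (u : Fin n → Fin ℓ) : LipschitzWith (c ^ n) (Φ.wordMap n u) := by
  induction n with
  | zero => simpa [wordMap] using LipschitzWith.id
  | succ n ih =>
    rw [pow_succ']
    exact (hc _).comp (ih _)

theorem wordMap_succ_last (Φ : IFS d ℓ) (n : ℕ) (u : Fin (n + 1) → Fin ℓ) :
    Φ.wordMap (n + 1) u = Φ.wordMap n (fun i => u i.castSucc) ∘ Φ.map (u (Fin.last n)) := by
  induction n with
  | zero => rfl
  | succ n ih =>
    rw [wordMap, ih, wordMap]
    rfl

/-- A nonempty compact set `K` with `K = ⋃ S_i(K)`. -/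
def IsAttractor (Φ : IFS d ℓ) (K : Set Φ.X) : Prop :=
  K.Nonempty ∧ IsCompact K ∧ K = ⋃ i, Φ.map i '' K

theorem existsUnique_attractor [NeZero ℓ] (Φ : IFS d ℓ) : ∃! K : Set Φ.X, Φ.IsAttractor K := by
  classical
  obtain ⟨c, hc1, hc⟩ := Φ.exists_ratio
  have : CompleteSpace Φ.X := Φ.isClosed_X.completeSpace_coe
  have : Nonempty Φ.X := Φ.nonempty_X.to_subtype
  let F : TopologicalSpace.NonemptyCompacts Φ.X → TopologicalSpace.NonemptyCompacts Φ.X :=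
    fun K => ⟨⟨⋃ i, Φ.map i '' K,
      isCompact_iUnion fun i => K.isCompact.image (hc i).continuous⟩,
      Set.nonempty_iUnion.2 ⟨0, K.nonempty.image _⟩⟩
  have hF : ContractingWith c F := by
    refine ⟨hc1, fun K L => ?_⟩
    have key : ∀ (K L : TopologicalSpace.NonemptyCompacts Φ.X) (i : Fin ℓ), ∀ x ∈ Φ.map i '' K,
        Metric.infEDist x (Φ.map i '' L) ≤ c * Metric.hausdorffEDist (K : Set Φ.X) L := by
      rintro K L i _ ⟨x, hx, rfl⟩
      obtain ⟨y, hy, hxy⟩ := L.isCompact.exists_infEDist_eq_edist L.nonempty x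
      calc Metric.infEDist (Φ.map i x) (Φ.map i '' L)
          ≤ edist (Φ.map i x) (Φ.map i y) :=
            Metric.infEDist_le_edist_of_mem (Set.mem_image_of_mem _ hy)
        _ ≤ c * edist x y := hc i x y
        _ ≤ c * Metric.hausdorffEDist (K : Set Φ.X) L := by
            rw [← hxy]
            gcongr
            exact Metric.infEDist_le_hausdorffEDist_of_mem hx
    change Metric.hausdorffEDist (⋃ i, Φ.map i '' (K : Set Φ.X)) (⋃ i, Φ.map i '' (L : Set Φ.X))
      ≤ c * Metric.hausdorffEDist (K : Set Φ.X) L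
    refine Metric.hausdorffEDist_iUnion_le.trans (iSup_le fun i => ?_)
    refine Metric.hausdorffEDist_le_of_infEDist (key K L i) ?_
    rw [Metric.hausdorffEDist_comm]
    exact key L K i
  have : Nonempty (TopologicalSpace.NonemptyCompacts Φ.X) :=
    ⟨⟨⟨{Classical.arbitrary _}, isCompact_singleton⟩, Set.singleton_nonempty _⟩⟩
  refine ⟨(ContractingWith.fixedPoint F hF : TopologicalSpace.NonemptyCompacts Φ.X),
    ⟨TopologicalSpace.NonemptyCompacts.nonempty _, TopologicalSpace.NonemptyCompacts.isCompact _,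
      ?_⟩, ?_⟩
  · exact congrArg (fun K : TopologicalSpace.NonemptyCompacts Φ.X => (K : Set Φ.X))
      hF.fixedPoint_isFixedPt.symm
  · rintro K ⟨h1, h2, h3⟩
    have : (⟨⟨K, h2⟩, h1⟩ : TopologicalSpace.NonemptyCompacts Φ.X) =
        ContractingWith.fixedPoint F hF := by
      apply hF.fixedPoint_unique
      ext1
      exact h3.symm
    exact congrArg (fun K : TopologicalSpace.NonemptyCompacts Φ.X => (K : Set Φ.X)) this

/-- The attractor: the unique nonempty compact set `K ⊆ X` with `K = ⋃ S_i(K)`. -/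
noncomputable def attractor [NeZero ℓ] (Φ : IFS d ℓ) : Set Φ.X :=
  Φ.existsUnique_attractor.exists.choose

theorem isAttractor_attractor [NeZero ℓ] (Φ : IFS d ℓ) : Φ.IsAttractor Φ.attractor :=
  Φ.existsUnique_attractor.exists.choose_spec

/-- The cylinder sets `S_{x_1} ∘ ⋯ ∘ S_{x_n}(K)` of a sequence `x` shrink to a single point. -/
theorem exists_iInter_eq_singleton [NeZero ℓ] (Φ : IFS d ℓ) (x : ℕ → Fin ℓ) :
    ∃ p : Φ.X, ⋂ n : ℕ, Φ.wordMap n (fun i => x i) '' Φ.attractor = {p} := by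
  obtain ⟨c, hc1, hc⟩ := Φ.exists_ratio
  obtain ⟨hne, hcp, heq⟩ := Φ.isAttractor_attractor
  have hmap : ∀ i, Φ.map i '' Φ.attractor ⊆ Φ.attractor := fun i => by
    conv_rhs => rw [heq]
    exact Set.subset_iUnion (fun i => Φ.map i '' Φ.attractor) i
  have hcpt : ∀ n, IsCompact (Φ.wordMap n (fun i => x i) '' Φ.attractor) := fun n =>
    hcp.image (Φ.lipschitzWith_wordMap hc n _).continuous
  obtain ⟨p, hp⟩ := IsCompact.nonempty_iInter_of_sequence_nonempty_isCompact_isClosed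
    (fun n : ℕ => Φ.wordMap n (fun i => x i) '' Φ.attractor)
    (fun n => by
      rw [wordMap_succ_last, Set.image_comp]
      exact Set.image_mono (hmap _))
    (fun n => hne.image _) (hcpt 0) (fun n => (hcpt n).isClosed)
  refine ⟨p, Set.eq_singleton_iff_unique_mem.2 ⟨hp, fun q hq => ?_⟩⟩
  have hb : Metric.ediam Φ.attractor ≠ ∞ := hcp.isBounded.ediam_ne_top
  have hle : ∀ n : ℕ, edist q p ≤ (c : ℝ≥0∞) ^ n * Metric.ediam Φ.attractor := fun n => by
    obtain ⟨a, ha, rfl⟩ := Set.mem_iInter.1 hq n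
    obtain ⟨b, hb, hbp⟩ := Set.mem_iInter.1 hp n
    rw [← hbp]
    refine (Φ.lipschitzWith_wordMap hc n _ a b).trans ?_
    push_cast
    gcongr
    exact Metric.edist_le_ediam_of_mem ha hb
  have hlim : Tendsto (fun n : ℕ => (c : ℝ≥0∞) ^ n * Metric.ediam Φ.attractor) atTop (𝓝 0) := by
    have := ENNReal.Tendsto.mul_const (b := Metric.ediam Φ.attractor)
      (ENNReal.tendsto_pow_atTop_nhds_zero_of_lt_one (r := (c : ℝ≥0∞)) (by exact_mod_cast hc1))
      (Or.inr hb)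
    simpa using this
  exact edist_le_zero.1 (ge_of_tendsto' hlim hle)

/-- The canonical projection `π` of the symbolic space, `{π x} = ⋂ S_{x_1} ∘ ⋯ ∘ S_{x_n}(K)`. -/
noncomputable def proj [NeZero ℓ] (Φ : IFS d ℓ) (x : ℕ → Fin ℓ) : EuclideanSpace ℝ (Fin d) :=
  (Φ.exists_iInter_eq_singleton x).choose

theorem iInter_eq_singleton_proj [NeZero ℓ] (Φ : IFS d ℓ) (x : ℕ → Fin ℓ) :
    ⋂ n : ℕ, ((↑) : Φ.X → EuclideanSpace ℝ (Fin d)) ''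
      (Φ.wordMap n (fun i => x i) '' Φ.attractor) = {Φ.proj x} := by
  rw [← Set.InjOn.image_iInter_eq Subtype.val_injective.injOn,
    (Φ.exists_iInter_eq_singleton x).choose_spec, Set.image_singleton]
  rfl

/-- The projection is continuous; in particular `π⁻¹γ` consists of Borel sets. -/
theorem continuous_proj [NeZero ℓ] (Φ : IFS d ℓ) : Continuous Φ.proj := by
  obtain ⟨c, hc1, hc⟩ := Φ.exists_ratio
  obtain ⟨hne, hcp, heq⟩ := Φ.isAttractor_attractor
  have hlim : Tendsto (fun n : ℕ => (c : ℝ) ^ n * Metric.diam Φ.attractor) atTop (𝓝 0) := by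
    simpa using (tendsto_pow_atTop_nhds_zero_of_lt_one c.2 (by exact_mod_cast hc1)).mul_const
      (Metric.diam Φ.attractor)
  rw [continuous_iff_continuousAt]
  intro x
  rw [ContinuousAt, Metric.tendsto_nhds]
  intro ε hε
  obtain ⟨n, hn⟩ := (hlim.eventually (gt_mem_nhds hε)).exists
  have hU : ∀ᶠ y in 𝓝 x, ∀ i : Fin n, y i = x i := by
    rw [eventually_all]
    intro i
    exact (continuous_apply (i : ℕ)).continuousAt.eventually
      (show ∀ᶠ a in 𝓝 (x i), a = x i by simp [nhds_discrete])
  filter_upwards [hU] with y hy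
  have hx : Φ.proj x ∈ ({Φ.proj x} : Set _) := rfl
  have hy' : Φ.proj y ∈ ({Φ.proj y} : Set _) := rfl
  rw [← iInter_eq_singleton_proj, Set.mem_iInter] at hx hy'
  obtain ⟨_, ⟨a, ha, rfl⟩, hax⟩ := hx n
  obtain ⟨_, ⟨b, hb, rfl⟩, hby⟩ := hy' n
  rw [← hax, ← hby, funext hy]
  refine lt_of_le_of_lt ?_ hn
  refine ((Φ.lipschitzWith_wordMap hc n _).dist_le_mul b a).trans ?_
  push_cast
  gcongr
  exact Metric.dist_le_diam_of_mem hcp.isBounded hb ha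

/-- `t_n = sup_{x ∈ ℝ^d} #{S_u : u ∈ {1,…,ℓ}^n, x ∈ S_u(K)}`, counting distinct maps `S_u`. -/
noncomputable def overlapCount [NeZero ℓ] (Φ : IFS d ℓ) (n : ℕ) : ℕ :=
  ⨆ x : EuclideanSpace ℝ (Fin d),
    {f : Φ.X → Φ.X | ∃ u : Fin n → Fin ℓ, f = Φ.wordMap n u ∧
      x ∈ ((↑) : Φ.X → EuclideanSpace ℝ (Fin d)) '' (Φ.wordMap n u '' Φ.attractor)}.ncard

/-- The supremum defining `overlapCount` is a genuine one. -/
theorem bddAbove_overlapCount [NeZero ℓ] (Φ : IFS d ℓ) (n : ℕ) :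
    BddAbove (Set.range fun x : EuclideanSpace ℝ (Fin d) =>
      {f : Φ.X → Φ.X | ∃ u : Fin n → Fin ℓ, f = Φ.wordMap n u ∧
        x ∈ ((↑) : Φ.X → EuclideanSpace ℝ (Fin d)) '' (Φ.wordMap n u '' Φ.attractor)}.ncard) := by
  refine ⟨(Set.range (Φ.wordMap n)).ncard, ?_⟩
  rintro _ ⟨x, rfl⟩
  refine Set.ncard_le_ncard ?_ (Set.finite_range _)
  rintro f ⟨u, rfl, -⟩
  exact ⟨u, rfl⟩

/-- The asymptotically weak separation condition. -/
def AWSC [NeZero ℓ] (Φ : IFS d ℓ) : Prop :=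
  Tendsto (fun n : ℕ => (1 / (n : ℝ)) * Real.log (Φ.overlapCount n)) atTop (𝓝 0)

end IFS

/-- The conditional information `I_μ(ξ | 𝒜) = - ∑_{A ∈ ξ} χ_A log E_μ(χ_A | 𝒜)` of a finite
partition `ξ` given a sub-`σ`-algebra `𝒜`. -/
noncomputable def condInformation {Ω ι : Type*} [Fintype ι] (𝒜 : MeasurableSpace Ω)
    {mΩ : MeasurableSpace Ω} (μ : Measure Ω) (ξ : ι → Set Ω) (ω : Ω) : ℝ :=
  -∑ i, (ξ i).indicator (fun _ => (1 : ℝ)) ω *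
    Real.log (condExp 𝒜 μ ((ξ i).indicator (fun _ => (1 : ℝ))) ω)

/-- The conditional entropy `H_μ(ξ | 𝒜) = ∫ I_μ(ξ | 𝒜) dμ`. -/
noncomputable def condEntropy {Ω ι : Type*} [Fintype ι] (𝒜 : MeasurableSpace Ω)
    {mΩ : MeasurableSpace Ω} (μ : Measure Ω) (ξ : ι → Set Ω) : ℝ :=
  ∫ ω, condInformation 𝒜 μ ξ ω ∂μ

/-- The left shift on `{1,…,ℓ}^ℕ`. -/
def shift {ℓ : ℕ} (x : ℕ → Fin ℓ) : ℕ → Fin ℓ := fun n => x (n + 1)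

/-- The partition of `{1,…,ℓ}^ℕ` according to the first symbol. -/
def firstSymbol {ℓ : ℕ} (j : Fin ℓ) : Set (ℕ → Fin ℓ) := {x | x 0 = j}

/-- The shift-invariant Borel probability measures, with the weak-star topology (inherited from the
topology of weak convergence on `ProbabilityMeasure`). -/
abbrev InvMeasure (ℓ : ℕ) : Type :=
  {m : ProbabilityMeasure (ℕ → Fin ℓ) // MeasurePreserving shift (m : Measure (ℕ → Fin ℓ)) m}

/-- The projection entropy `h_π(σ, m) = H_m(𝒫 | σ⁻¹π⁻¹γ) - H_m(𝒫 | π⁻¹γ)`, with `γ` the Borel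
`σ`-algebra of `ℝ^d`. -/
noncomputable def IFS.projEntropy {d ℓ : ℕ} [NeZero ℓ] (Φ : IFS d ℓ)
    (m : Measure (ℕ → Fin ℓ)) : ℝ :=
  condEntropy (((borel (EuclideanSpace ℝ (Fin d))).comap Φ.proj).comap shift) m firstSymbol -
    condEntropy ((borel (EuclideanSpace ℝ (Fin d))).comap Φ.proj) m firstSymbol

/-! Let Q_n be the partition of Σ according to the map S_{x|n} given by the first n letters. For
invariant m, n·h_π(σ,m) = F_n(m) − G_n(m), where F_n(m) = H_m(Q_n | σ⁻ⁿπ⁻¹γ) and G_n(m) = H_m(Q_n |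
π⁻¹γ) (`nsmul_projEntropy_eq`). Given π x, only maps whose image of K contains π x can occur, so 0 ≤
G_n ≤ log t_n (`condEntropy_wordMapPartition_le`). Under AWSC, h_π is therefore a uniform limit of
functions F_n/n, and it suffices that each F_n is upper semicontinuous.

The identity comes from `condEntropy_comap_sub_comap`: if two observables determine each other on
every class of a coarser partition, replacing one by the other changes the entropies of the fine and
the coarse partition equally. Injectivity supplies this for π x and π(σⁿx) on a cell of Q_n, since
there π x = S_u(π(σⁿx)) with S_u fixed. Used one letter at a time, the same fact telescopes n·h_π
into the entropies of words; used once more, it passes from words to maps.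

Semicontinuity is variational: −p log p is the minimum over h ≥ 0 of ph + e⁻ʰ − p for p in (0,1].
Hence the entropy of a clopen cell A given a continuous T is an infimum of integrals of the bounded
continuous functions 1_A·h(T) + e^{−h(T)} − 1_A
(`upperSemicontinuous_integral_negMulLog_condProbability`). -/

/-! ### Conditional probabilities and the integrals of their logarithms. -/

section ConditionalProbability

variable {Ω : Type*} {m m₀ : MeasurableSpace Ω} {μ : Measure Ω}

/-- The conditional probability of the event `A` given the sub-`σ`-algebra `m`. -/
noncomputable def condProbability (m : MeasurableSpace Ω) {m₀ : MeasurableSpace Ω}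
    (μ : Measure Ω) (A : Set Ω) : Ω → ℝ :=
  condExp m μ (A.indicator fun _ => (1 : ℝ))

theorem stronglyMeasurable_condProbability (A : Set Ω) :
    StronglyMeasurable[m] (condProbability m μ A) :=
  stronglyMeasurable_condExp

theorem integrable_condProbability (A : Set Ω) : Integrable (condProbability m μ A) μ :=
  integrable_condExp

theorem condProbability_nonneg (A : Set Ω) : ∀ᵐ ω ∂μ, 0 ≤ condProbability m μ A ω :=
  condExp_nonneg (Eventually.of_forall fun _ => Set.indicator_nonneg (fun _ _ => zero_le_one) _)

variable [IsFiniteMeasure μ]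

theorem integrable_indicator_one {A : Set Ω} (hA : MeasurableSet A) :
    Integrable (A.indicator fun _ => (1 : ℝ)) μ :=
  (integrable_const 1).indicator hA

theorem condProbability_mono {A B : Set Ω} (hA : MeasurableSet A) (hB : MeasurableSet B)
    (h : A ⊆ B) : condProbability m μ A ≤ᵐ[μ] condProbability m μ B :=
  condExp_mono (integrable_indicator_one hA) (integrable_indicator_one hB)
    (Eventually.of_forall fun _ => Set.indicator_le_indicator_of_subset h (fun _ => zero_le_one) _)

theorem condProbability_univ (hm : m ≤ m₀) : condProbability m μ Set.univ = fun _ => 1 := by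
  simp [condProbability, condExp_const hm]

theorem condProbability_le_one (hm : m ≤ m₀) {A : Set Ω} (hA : MeasurableSet A) :
    ∀ᵐ ω ∂μ, condProbability m μ A ω ≤ 1 := by
  filter_upwards [condProbability_mono (m := m) (μ := μ) hA .univ (Set.subset_univ A)] with ω hω
  simpa [condProbability_univ hm] using hω

theorem sum_condProbability (hm : m ≤ m₀) {ι : Type*} [Fintype ι] {X : Ω → ι}
    (hX : ∀ i, MeasurableSet (X ⁻¹' {i})) :
    ∀ᵐ ω ∂μ, ∑ i, condProbability m μ (X ⁻¹' {i}) ω = 1 := by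
  classical
  have h := condExp_finsetSum (s := Finset.univ)
    (fun i _ => integrable_indicator_one (μ := μ) (hX i)) m
  have h1 : (∑ i, (X ⁻¹' {i}).indicator fun _ => (1 : ℝ)) = fun _ => (1 : ℝ) := by
    ext ω
    simp [Finset.sum_apply, Set.indicator_apply]
  rw [h1, condExp_const hm] at h
  filter_upwards [h] with ω hω
  simpa [condProbability] using hω.symm

/-- On `m`, the conditional probability is the density of μ restricted to A with respect to μ.
Working in `ℝ≥0∞` allows g = −log of the conditional probability before its integrability is known.
-/
theorem setLIntegral_eq_lintegral_condProbability_mul (hm : m ≤ m₀) {A : Set Ω}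
    (hA : MeasurableSet A) {g : Ω → ℝ≥0∞} (hg : Measurable[m] g) :
    ∫⁻ ω in A, g ω ∂μ = ∫⁻ ω, ENNReal.ofReal (condProbability m μ A ω) * g ω ∂μ := by
  have hp : Measurable[m] fun ω => ENNReal.ofReal (condProbability m μ A ω) :=
    (stronglyMeasurable_condProbability A).measurable.ennreal_ofReal
  have key : (μ.restrict A).trim hm =
      (μ.trim hm).withDensity fun ω => ENNReal.ofReal (condProbability m μ A ω) := by
    refine @Measure.ext _ m _ _ fun s hs => ?_
    rw [trim_measurableSet_eq hm hs, withDensity_apply _ hs, setLIntegral_trim hm hp hs,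
      Measure.restrict_apply (hm _ hs),
      ← ofReal_integral_eq_lintegral_ofReal (integrable_condProbability A).integrableOn
        (ae_restrict_of_ae (condProbability_nonneg A)), condProbability,
      setIntegral_condExp hm (integrable_indicator_one hA) hs, integral_indicator_const _ hA]
    simp [measureReal_def, Measure.restrict_apply hA, Set.inter_comm]
  rw [← lintegral_trim hm hg, key, lintegral_withDensity_eq_lintegral_mul _ hp hg,
    lintegral_trim hm (hp.mul hg)]
  rfl

/-- The event that the conditional probability is ≤ 0 belongs to `m`, so the mass it shares with A
is the integral over it of a density that vanishes there. -/
theorem condProbability_pos (hm : m ≤ m₀) {A : Set Ω} (hA : MeasurableSet A) :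
    ∀ᵐ ω ∂μ.restrict A, 0 < condProbability m μ A ω := by
  have hs : MeasurableSet[m] {ω | condProbability m μ A ω ≤ 0} :=
    (stronglyMeasurable_condProbability A).measurable measurableSet_Iic
  have h := setLIntegral_eq_lintegral_condProbability_mul (μ := μ) hm hA
    (g := {ω | condProbability m μ A ω ≤ 0}.indicator 1) ((@measurable_one _ _ _ m _).indicator hs)
  rw [lintegral_indicator_one (hm _ hs)] at h
  have h0 : ∀ ω, ENNReal.ofReal (condProbability m μ A ω) *
      {ω | condProbability m μ A ω ≤ 0}.indicator 1 ω = 0 := fun ω => by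
    by_cases hω : condProbability m μ A ω ≤ 0
    · simp [ENNReal.ofReal_of_nonpos hω]
    · simp [hω]
  simp only [h0, lintegral_zero] at h
  rw [ae_iff]
  simpa using h

theorem lintegral_neg_log_condProbability (hm : m ≤ m₀) {A : Set Ω} (hA : MeasurableSet A) :
    ∫⁻ ω in A, ENNReal.ofReal (-Real.log (condProbability m μ A ω)) ∂μ =
      ∫⁻ ω, ENNReal.ofReal (Real.negMulLog (condProbability m μ A ω)) ∂μ := by
  rw [setLIntegral_eq_lintegral_condProbability_mul hm hA
    (g := fun ω => ENNReal.ofReal (-Real.log (condProbability m μ A ω)))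
    (Real.measurable_log.comp
      (stronglyMeasurable_condProbability A).measurable).neg.ennreal_ofReal]
  refine lintegral_congr_ae ?_
  filter_upwards [condProbability_nonneg (m := m) (μ := μ) A] with ω hω
  rw [← ENNReal.ofReal_mul hω, Real.negMulLog]
  ring_nf

theorem integrable_negMulLog_condProbability (hm : m ≤ m₀) {A : Set Ω} (hA : MeasurableSet A) :
    Integrable (fun ω => Real.negMulLog (condProbability m μ A ω)) μ := by
  refine Integrable.of_bound (C := 1) (Real.continuous_negMulLog.comp_aestronglyMeasurable
    (integrable_condProbability A).aestronglyMeasurable) ?_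
  filter_upwards [condProbability_nonneg (m := m) (μ := μ) A, condProbability_le_one hm hA]
    with ω h0 h1
  rw [Real.norm_of_nonneg (Real.negMulLog_nonneg h0 h1)]
  linarith [Real.negMulLog_le_one_sub_self h0]

theorem integrableOn_neg_log_condProbability (hm : m ≤ m₀) {A : Set Ω} (hA : MeasurableSet A) :
    IntegrableOn (fun ω => -Real.log (condProbability m μ A ω)) A μ := by
  have hmeas : AEStronglyMeasurable (fun ω => -Real.log (condProbability m μ A ω))
      (μ.restrict A) := ((Real.measurable_log.comp
        (stronglyMeasurable_condProbability A).measurable).neg.mono hm le_rfl).aestronglyMeasurable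
  refine ⟨hmeas, ?_⟩
  rw [hasFiniteIntegral_iff_ofReal, lintegral_neg_log_condProbability hm hA]
  · exact (integrable_negMulLog_condProbability hm hA).lintegral_lt_top
  · filter_upwards [ae_restrict_of_ae (condProbability_nonneg (m := m) (μ := μ) A),
      ae_restrict_of_ae (condProbability_le_one (m := m) (μ := μ) hm hA)] with ω h0 h1
    simpa using Real.log_nonpos h0 h1

theorem setIntegral_neg_log_condProbability (hm : m ≤ m₀) {A : Set Ω} (hA : MeasurableSet A) :
    ∫ ω in A, -Real.log (condProbability m μ A ω) ∂μ =
      ∫ ω, Real.negMulLog (condProbability m μ A ω) ∂μ := by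
  rw [integral_eq_lintegral_of_nonneg_ae, integral_eq_lintegral_of_nonneg_ae,
    lintegral_neg_log_condProbability hm hA]
  · filter_upwards [condProbability_nonneg (m := m) (μ := μ) A, condProbability_le_one hm hA]
      with ω h0 h1 using Real.negMulLog_nonneg h0 h1
  · exact (integrable_negMulLog_condProbability hm hA).aestronglyMeasurable
  · filter_upwards [ae_restrict_of_ae (condProbability_nonneg (m := m) (μ := μ) A),
      ae_restrict_of_ae (condProbability_le_one (m := m) (μ := μ) hm hA)] with ω h0 h1
    simpa using Real.log_nonpos h0 h1
  · exact (integrableOn_neg_log_condProbability hm hA).aestronglyMeasurable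

theorem condEntropy_eq_sum_setIntegral (hm : m ≤ m₀) {ι : Type*} [Fintype ι] {ξ : ι → Set Ω}
    (hξ : ∀ i, MeasurableSet (ξ i)) :
    condEntropy m μ ξ = ∑ i, ∫ ω in ξ i, -Real.log (condProbability m μ (ξ i) ω) ∂μ := by
  have h : ∀ ω, condInformation m μ ξ ω =
      ∑ i, (ξ i).indicator (fun ω => -Real.log (condProbability m μ (ξ i) ω)) ω := fun ω => by
    rw [condInformation, ← Finset.sum_neg_distrib]
    refine Finset.sum_congr rfl fun i _ => ?_
    by_cases hi : ω ∈ ξ i <;> simp [hi, condProbability]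
  simp_rw [condEntropy, h]
  rw [integral_finsetSum]
  · exact Finset.sum_congr rfl fun i _ => integral_indicator (hξ i)
  · exact fun i _ => (integrableOn_neg_log_condProbability hm (hξ i)).integrable_indicator (hξ i)

theorem condEntropy_eq_sum_integral_negMulLog (hm : m ≤ m₀) {ι : Type*} [Fintype ι]
    {ξ : ι → Set Ω} (hξ : ∀ i, MeasurableSet (ξ i)) :
    condEntropy m μ ξ = ∑ i, ∫ ω, Real.negMulLog (condProbability m μ (ξ i) ω) ∂μ := by
  rw [condEntropy_eq_sum_setIntegral hm hξ]
  exact Finset.sum_congr rfl fun i _ => setIntegral_neg_log_condProbability hm (hξ i)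

theorem condEntropy_nonneg (hm : m ≤ m₀) {ι : Type*} [Fintype ι] {ξ : ι → Set Ω}
    (hξ : ∀ i, MeasurableSet (ξ i)) : 0 ≤ condEntropy m μ ξ := by
  rw [condEntropy_eq_sum_integral_negMulLog hm hξ]
  refine Finset.sum_nonneg fun i _ => integral_nonneg_of_ae ?_
  filter_upwards [condProbability_nonneg (m := m) (μ := μ) (ξ i), condProbability_le_one hm (hξ i)]
    with ω h0 h1 using Real.negMulLog_nonneg h0 h1

/-- The density of `E` relative to a larger set `F`, conditionally on `m`. -/
theorem setLIntegral_condProbability_div (hm : m ≤ m₀) {E F s : Set Ω} (hE : MeasurableSet E)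
    (hF : MeasurableSet F) (h : E ⊆ F) (hs : MeasurableSet[m] s) :
    ∫⁻ ω in s, ENNReal.ofReal (condProbability m μ E ω) /
      ENNReal.ofReal (condProbability m μ F ω) ∂μ.restrict F = μ (E ∩ s) := by
  have hmeas : ∀ A, Measurable[m] fun ω => ENNReal.ofReal (condProbability m μ A ω) := fun A =>
    (stronglyMeasurable_condProbability A).measurable.ennreal_ofReal
  have h1 : ∫⁻ ω in E, s.indicator 1 ω ∂μ = μ (E ∩ s) := by
    rw [lintegral_indicator_one (hm _ hs), Measure.restrict_apply (hm _ hs), Set.inter_comm]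
  rw [← lintegral_indicator (hm _ hs), setLIntegral_eq_lintegral_condProbability_mul hm hF
    (Measurable.indicator (f := fun ω => ENNReal.ofReal (condProbability m μ E ω) /
      ENNReal.ofReal (condProbability m μ F ω)) ((hmeas E).div (hmeas F)) hs), ← h1,
    setLIntegral_eq_lintegral_condProbability_mul hm hE ((@measurable_one _ _ _ m _).indicator hs)]
  refine lintegral_congr_ae ?_
  filter_upwards [condProbability_mono (m := m) (μ := μ) hE hF h] with ω hω
  by_cases hωs : ω ∈ s
  · simp only [Set.indicator_of_mem hωs, Pi.one_apply, mul_one]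
    -- Where the density of F vanishes, so does that of E by monotonicity; the convention for 0/0 is
    -- harmless.
    refine ENNReal.mul_div_cancel' (fun h0 => ?_) (fun h0 => (ENNReal.ofReal_ne_top h0).elim)
    rw [ENNReal.ofReal_eq_zero] at h0 ⊢
    exact hω.trans h0
  · simp [hωs]

/-- Conditional densities relative to `F` only depend on the trace of the `σ`-algebra on `F`. -/
theorem condProbability_div_ae_eq {Y Z : Type*} [MeasurableSpace Y] [MeasurableSpace Z]
    {S : Ω → Y} {T : Ω → Z} (hS : Measurable S) (hT : Measurable T) {R : Z → Y} {R' : Y → Z}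
    (hR : Measurable R) (hR' : Measurable R') {E F : Set Ω} (hE : MeasurableSet E)
    (hF : MeasurableSet F) (h : E ⊆ F) (hST : ∀ ω ∈ F, S ω = R (T ω))
    (hTS : ∀ ω ∈ F, T ω = R' (S ω)) :
    ∀ᵐ ω ∂μ.restrict F,
      condProbability (MeasurableSpace.comap S inferInstance) μ E ω /
        condProbability (MeasurableSpace.comap S inferInstance) μ F ω =
      condProbability (MeasurableSpace.comap T inferInstance) μ E ω /
        condProbability (MeasurableSpace.comap T inferInstance) μ F ω := by
  set mS := MeasurableSpace.comap S inferInstance with hmS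
  set mT := MeasurableSpace.comap T inferInstance with hmT
  let r (m : MeasurableSpace Ω) (ω : Ω) : ℝ≥0∞ := ENNReal.ofReal (condProbability m μ E ω) /
      ENNReal.ofReal (condProbability m μ F ω)
  have hmeas : ∀ m : MeasurableSpace Ω, Measurable[m] (r m) := fun m =>
    (stronglyMeasurable_condProbability E).measurable.ennreal_ofReal.div
      (stronglyMeasurable_condProbability F).measurable.ennreal_ofReal
  -- The T-ratio is ρ(T), and on F it equals ρ(R'(S)), which is S-measurable and so can be compared
  -- with the S-ratio.
  obtain ⟨ρ, hρ, hρT⟩ := (hmeas mT).exists_eq_measurable_comp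
  have hr' : Measurable[mS] (ρ ∘ R' ∘ S) :=
    (hρ.comp hR').comp (Measurable.of_comap_le le_rfl)
  have hae : r mT =ᵐ[μ.restrict F] ρ ∘ R' ∘ S := by
    filter_upwards [ae_restrict_mem hF] with ω hω
    simp [hρT, hTS ω hω]
  have hle : mS ≤ m₀ := hS.comap_le
  -- Uniqueness of densities: over S⁻¹t both functions integrate to μ(E ∩ S⁻¹t), because S⁻¹t and
  -- T⁻¹(R⁻¹t) have the same trace on F.
  have key : r mS =ᵐ[(μ.restrict F).trim hle] ρ ∘ R' ∘ S := by
    refine @ae_eq_of_forall_setLIntegral_eq_of_sigmaFinite _ mS _ _ _ _ (hmeas mS) hr' ?_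
    intro s hs _
    rw [setLIntegral_trim hle (hmeas mS) hs, setLIntegral_trim hle hr' hs,
      setLIntegral_condProbability_div hle hE hF h hs]
    rw [← setLIntegral_congr_fun_ae (hle _ hs) (hae.mono fun ω hω _ => hω)]
    obtain ⟨t, ht, rfl⟩ := hs
    have h1 := setLIntegral_condProbability_div (μ := μ) hT.comap_le hE hF h
      (s := T ⁻¹' (R ⁻¹' t)) ⟨_, hR ht, rfl⟩
    have h2 : ∀ G : Set Ω, G ⊆ F → G ∩ T ⁻¹' (R ⁻¹' t) = G ∩ S ⁻¹' t := fun G hG => by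
      ext ω
      simp only [Set.mem_inter_iff, Set.mem_preimage, and_congr_right_iff]
      intro hω
      rw [hST ω (hG hω)]
    rw [h2 E h, Measure.restrict_restrict (hT (hR ht)), Set.inter_comm, h2 F subset_rfl] at h1
    rw [Measure.restrict_restrict (hS ht), Set.inter_comm (S ⁻¹' t)]
    exact h1.symm
  filter_upwards [ae_eq_of_ae_eq_trim key, hae,
    ae_restrict_of_ae (condProbability_nonneg (m := mS) (μ := μ) E),
    ae_restrict_of_ae (condProbability_nonneg (m := mT) (μ := μ) E),
    condProbability_pos (m := mS) hle hF,
    condProbability_pos (m := mT) hT.comap_le hF] with ω h1 h2 h3 h4 h5 h6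
  have := congrArg ENNReal.toReal (h1.trans h2.symm)
  simpa [r, ENNReal.toReal_ofReal, h3, h4, h5.le, h6.le] using this

end ConditionalProbability

/-! ### Gibbs' inequality and conditional entropies of finite partitions. -/

/-- This is log t ≤ t − 1 at t = e⁻ʰ/p, with equality at h = −log p. The bound is affine in p, so p
may be exchanged for an indicator under the integral. -/
theorem Real.negMulLog_le_mul_add_exp_neg_sub {p : ℝ} (hp : 0 ≤ p) (h : ℝ) :
    Real.negMulLog p ≤ p * h + Real.exp (-h) - p := by
  rcases hp.eq_or_lt with rfl | hp
  · simpa using (Real.exp_pos _).le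
  have h1 := mul_le_mul_of_nonneg_left
    (Real.log_le_sub_one_of_pos (div_pos (Real.exp_pos (-h)) hp)) hp.le
  rw [Real.log_div (Real.exp_pos _).ne' hp.ne', Real.log_exp, mul_sub, mul_sub,
    mul_div_cancel₀ _ hp.ne'] at h1
  rw [Real.negMulLog]
  linarith

section CondEntropy

variable {Ω : Type*} {m m₀ : MeasurableSpace Ω} {μ : Measure Ω} {ι κ : Type*} [Fintype ι]

theorem measurableSet_preimage_comp {X : Ω → ι} (hX : ∀ i, MeasurableSet (X ⁻¹' {i}))
    (G : ι → κ) (k : κ) : MeasurableSet ((G ∘ X) ⁻¹' {k}) := by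
  have : (G ∘ X) ⁻¹' {k} = ⋃ i ∈ G ⁻¹' {k}, X ⁻¹' {i} := by
    ext ω
    simp
  rw [this]
  exact .biUnion (Set.to_countable _) fun i _ => hX i

variable [Fintype κ]

/-- The chain rule for the conditional entropy of a partition and a coarser one. -/
theorem condEntropy_sub_condEntropy_comp [IsFiniteMeasure μ] (hm : m ≤ m₀) {X : Ω → ι}
    (hX : ∀ i, MeasurableSet (X ⁻¹' {i})) (G : ι → κ) :
    condEntropy m μ (fun i => X ⁻¹' {i}) - condEntropy m μ (fun k => (G ∘ X) ⁻¹' {k}) =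
      ∑ i, ∫ ω in X ⁻¹' {i}, -Real.log (condProbability m μ (X ⁻¹' {i}) ω /
        condProbability m μ ((G ∘ X) ⁻¹' {G i}) ω) ∂μ := by
  classical
  have hF := measurableSet_preimage_comp hX G
  have hsub : ∀ i, X ⁻¹' {i} ⊆ (G ∘ X) ⁻¹' {G i} := fun i ω hω => congrArg G hω
  have hG : condEntropy m μ (fun k => (G ∘ X) ⁻¹' {k}) =
      ∑ i, ∫ ω in X ⁻¹' {i}, -Real.log (condProbability m μ ((G ∘ X) ⁻¹' {G i}) ω) ∂μ := by
    -- Each class is cut into its cells, so that both entropies become sums over the same cells.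
    rw [condEntropy_eq_sum_setIntegral hm hF, ← Finset.sum_fiberwise _ G]
    refine Finset.sum_congr rfl fun k _ => ?_
    have hU : (G ∘ X) ⁻¹' {k} = ⋃ i ∈ Finset.univ.filter fun i => G i = k, X ⁻¹' {i} := by
      ext ω
      simp
    conv_lhs => rw [hU]
    rw [integral_biUnion_finset _ fun i _ => hX i]
    · refine Finset.sum_congr rfl fun i hi => ?_
      rw [(Finset.mem_filter.1 hi).2, ← hU]
    · intro i _ j _ hij
      exact Disjoint.preimage _ (Set.disjoint_singleton.2 hij)
    · intro i hi
      rw [← hU]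
      refine (integrableOn_neg_log_condProbability hm (hF k)).mono_set ?_
      rw [← (Finset.mem_filter.1 hi).2]
      exact hsub i
  rw [hG, condEntropy_eq_sum_setIntegral hm hX, ← Finset.sum_sub_distrib]
  refine Finset.sum_congr rfl fun i _ => ?_
  rw [← integral_sub (integrableOn_neg_log_condProbability hm (hX i))
    ((integrableOn_neg_log_condProbability hm (hF (G i))).mono_set (hsub i))]
  refine integral_congr_ae ?_
  filter_upwards [condProbability_pos (m := m) hm (hX i),
    ae_restrict_of_ae_restrict_of_subset (hsub i) (condProbability_pos (m := m) hm (hF (G i)))]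
    with ω h1 h2
  rw [Real.log_div h1.ne' h2.ne']
  ring

/-- If `S` and `T` determine each other given the class `G ∘ X`, then conditioning on `S` or on `T`
changes the entropies of `X` and of `G ∘ X` by the same amount. -/
theorem condEntropy_comap_sub_comap [IsFiniteMeasure μ] {Y Z : Type*} [MeasurableSpace Y]
    [MeasurableSpace Z] {S : Ω → Y} {T : Ω → Z} (hS : Measurable S) (hT : Measurable T)
    {X : Ω → ι} (hX : ∀ i, MeasurableSet (X ⁻¹' {i})) (G : ι → κ)
    (h : ∀ k, ∃ (R : Z → Y) (R' : Y → Z), Measurable R ∧ Measurable R' ∧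
      ∀ ω, G (X ω) = k → S ω = R (T ω) ∧ T ω = R' (S ω)) :
    condEntropy (MeasurableSpace.comap S inferInstance) μ (fun i => X ⁻¹' {i}) -
        condEntropy (MeasurableSpace.comap T inferInstance) μ (fun i => X ⁻¹' {i}) =
      condEntropy (MeasurableSpace.comap S inferInstance) μ (fun k => (G ∘ X) ⁻¹' {k}) -
        condEntropy (MeasurableSpace.comap T inferInstance) μ (fun k => (G ∘ X) ⁻¹' {k}) := by
  have h1 := condEntropy_sub_condEntropy_comp (μ := μ) hS.comap_le hX G
  have h2 := condEntropy_sub_condEntropy_comp (μ := μ) hT.comap_le hX G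
  -- Regrouped by conditioning, each side is a fine-minus-coarse entropy, which the chain rule
  -- expresses through the ratios compared in `condProbability_div_ae_eq`.
  rw [sub_eq_sub_iff_sub_eq_sub, h1, h2]
  refine Finset.sum_congr rfl fun i _ => integral_congr_ae ?_
  obtain ⟨R, R', hR, hR', hRR⟩ := h (G i)
  have hsub : X ⁻¹' {i} ⊆ (G ∘ X) ⁻¹' {G i} := fun ω hω => congrArg G hω
  filter_upwards [ae_restrict_of_ae_restrict_of_subset hsub
    (condProbability_div_ae_eq (μ := μ) hS hT hR hR' (hX i) (measurableSet_preimage_comp hX G _)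
      hsub (fun ω hω => (hRR ω hω).1) fun ω hω => (hRR ω hω).2)] with ω hω
  rw [hω]

/-- Invariance of μ transports the defining integrals over T⁻¹t to those over (T ∘ S)⁻¹t, and these
characterise the conditional expectation. -/
theorem condProbability_comp [IsFiniteMeasure μ] {Z : Type*} [MeasurableSpace Z] {S : Ω → Ω}
    (hS : MeasurePreserving S μ μ) {T : Ω → Z} (hT : Measurable T) {A : Set Ω}
    (hA : MeasurableSet A) :
    condProbability (MeasurableSpace.comap T inferInstance) μ A ∘ S =ᵐ[μ]
      condProbability (MeasurableSpace.comap (T ∘ S) inferInstance) μ (S ⁻¹' A) := by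
  have hm : AEStronglyMeasurable (condProbability (MeasurableSpace.comap T inferInstance) μ A)
      (μ.map S) := by
    rw [hS.map_eq]
    exact (integrable_condProbability A).aestronglyMeasurable
  have hint : Integrable (condProbability (MeasurableSpace.comap T inferInstance) μ A ∘ S) μ :=
    (hS.integrable_comp (integrable_condProbability A).aestronglyMeasurable).2
      (integrable_condProbability A)
  refine ae_eq_condExp_of_forall_setIntegral_eq (hT.comp hS.measurable).comap_le
    (integrable_indicator_one (hS.measurable hA)) (fun _ _ _ => hint.integrableOn) ?_ ?_
  · rintro _ ⟨t, ht, rfl⟩ -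
    have h1 := setIntegral_map (hT ht) hm hS.measurable.aemeasurable
    have h2 := setIntegral_map (μ := μ) (hT ht) (f := A.indicator fun _ => (1 : ℝ))
      ((stronglyMeasurable_const.indicator hA).aestronglyMeasurable) hS.measurable.aemeasurable
    rw [hS.map_eq] at h1 h2
    rw [Set.preimage_comp]
    refine h1.symm.trans (Eq.trans ?_ h2)
    exact setIntegral_condExp hT.comap_le (integrable_indicator_one hA) ⟨t, ht, rfl⟩
  · refine StronglyMeasurable.aestronglyMeasurable ?_
    rw [← MeasurableSpace.comap_comp]
    exact (stronglyMeasurable_condProbability A).comp_measurable (comap_measurable S)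

theorem condEntropy_comap_comp [IsFiniteMeasure μ] {Z : Type*} [MeasurableSpace Z] {S : Ω → Ω}
    (hS : MeasurePreserving S μ μ) {T : Ω → Z} (hT : Measurable T) {ξ : ι → Set Ω}
    (hξ : ∀ i, MeasurableSet (ξ i)) :
    condEntropy (MeasurableSpace.comap (T ∘ S) inferInstance) μ (fun i => S ⁻¹' ξ i) =
      condEntropy (MeasurableSpace.comap T inferInstance) μ ξ := by
  rw [condEntropy_eq_sum_integral_negMulLog (hT.comp hS.measurable).comap_le
    fun i => hS.measurable (hξ i), condEntropy_eq_sum_integral_negMulLog hT.comap_le hξ]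
  refine Finset.sum_congr rfl fun i _ => ?_
  have hm : AEStronglyMeasurable (fun ω => Real.negMulLog
      (condProbability (MeasurableSpace.comap T inferInstance) μ (ξ i) ω)) (μ.map S) := by
    rw [hS.map_eq]
    exact (integrable_negMulLog_condProbability hT.comap_le (hξ i)).aestronglyMeasurable
  have h := integral_map hS.measurable.aemeasurable hm
  rw [hS.map_eq] at h
  rw [h]
  refine integral_congr_ae ?_
  filter_upwards [condProbability_comp hS hT (hξ i)] with ω hω
  rw [← hω, Function.comp_apply]

theorem condProbability_eq_zero [IsFiniteMeasure μ] (hm : m ≤ m₀) {A C : Set Ω}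
    (hA : MeasurableSet A) (hC : MeasurableSet[m] C) (h : A ⊆ C) :
    ∀ᵐ ω ∂μ, ω ∉ C → condProbability m μ A ω = 0 := by
  have h1 := setLIntegral_eq_lintegral_condProbability_mul (μ := μ) hm hA
    (g := Cᶜ.indicator 1) ((@measurable_one _ _ _ m _).indicator hC.compl)
  rw [lintegral_indicator_one (hm _ hC).compl, Measure.restrict_apply (hm _ hC).compl,
    Set.disjoint_iff_inter_eq_empty.1 (Set.disjoint_compl_left_iff_subset.2 h), measure_empty,
    eq_comm, lintegral_eq_zero_iff] at h1
  · filter_upwards [h1, condProbability_nonneg (m := m) (μ := μ) A] with ω hω h0 hωC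
    have : ω ∈ Cᶜ := hωC
    simp only [Set.indicator_of_mem this, Pi.one_apply, mul_one, Pi.zero_apply,
      ENNReal.ofReal_eq_zero] at hω
    exact le_antisymm hω h0
  · exact (((stronglyMeasurable_condProbability A).measurable.mono hm le_rfl).ennreal_ofReal).mul
      (measurable_one.indicator (hm _ hC).compl)

/-- The conditional entropy is at most `log N` if, given the conditioning, at most `N` of the cells
are possible. -/
theorem condEntropy_le_log [IsProbabilityMeasure μ] (hm : m ≤ m₀) {X : Ω → ι}
    (hX : ∀ i, MeasurableSet (X ⁻¹' {i})) {C : ι → Set Ω} (hC : ∀ i, MeasurableSet[m] (C i))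
    (hXC : ∀ i, X ⁻¹' {i} ⊆ C i) {N : ℕ} (hN : ∀ ω, {i | ω ∈ C i}.ncard ≤ N) :
    condEntropy m μ (fun i => X ⁻¹' {i}) ≤ Real.log N := by
  classical
  have hint := fun i => integrable_negMulLog_condProbability (μ := μ) hm (hX i)
  rw [condEntropy_eq_sum_integral_negMulLog hm hX, ← integral_finsetSum _ fun i _ => hint i]
  have : Real.log N = ∫ _, Real.log N ∂μ := by simp
  rw [this]
  refine integral_mono_ae (integrable_finsetSum _ fun i _ => hint i) (integrable_const _) ?_
  have h0 : ∀ᵐ ω ∂μ, ∀ i, ω ∉ C i → condProbability m μ (X ⁻¹' {i}) ω = 0 :=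
    ae_all_iff.2 fun i => condProbability_eq_zero hm (hX i) (hC i) (hXC i)
  have h1 : ∀ᵐ ω ∂μ, ∀ i, 0 ≤ condProbability m μ (X ⁻¹' {i}) ω :=
    ae_all_iff.2 fun i => condProbability_nonneg _
  filter_upwards [h0, h1, sum_condProbability (μ := μ) hm hX] with ω h0 h1 hs
  have hcard : (Finset.univ.filter fun i => ω ∈ C i).card ≤ N := by
    refine le_trans (le_of_eq ?_) (hN ω)
    rw [← Set.ncard_coe_finset]
    simp
  have hNpos : (0 : ℝ) < N := by
    have : X ω ∈ Finset.univ.filter fun i => ω ∈ C i := by simpa using hXC (X ω) rfl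
    exact_mod_cast (Finset.card_pos.2 ⟨_, this⟩).trans_le hcard
  -- Gibbs' inequality with h = log N: each admissible cell contributes an extra 1/N, for a total of
  -- at most 1, which cancels the sum of the probabilities.
  calc ∑ i, Real.negMulLog (condProbability m μ (X ⁻¹' {i}) ω)
      ≤ ∑ i, (condProbability m μ (X ⁻¹' {i}) ω * Real.log N + (if ω ∈ C i then (N : ℝ)⁻¹ else 0)
          - condProbability m μ (X ⁻¹' {i}) ω) := by
        refine Finset.sum_le_sum fun i _ => ?_
        split_ifs with hi
        · simpa [Real.exp_neg, Real.exp_log hNpos] using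
            Real.negMulLog_le_mul_add_exp_neg_sub (h1 i) (Real.log N)
        · simp [h0 i hi]
    _ = Real.log N + (Finset.univ.filter fun i => ω ∈ C i).card * (N : ℝ)⁻¹ - 1 := by
        rw [Finset.sum_sub_distrib, Finset.sum_add_distrib, ← Finset.sum_mul, hs,
          ← Finset.sum_filter]
        simp
    _ ≤ Real.log N + N * (N : ℝ)⁻¹ - 1 := by gcongr
    _ = Real.log N := by rw [mul_inv_cancel₀ hNpos.ne']; ring

end CondEntropy

/-! ### The variational formula and upper semicontinuity in the measure. -/

/-- Gibbs' inequality is nearly sharp for h near −log p. Truncating p below at δ keeps the target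
bounded at the cost δ; ph and e⁻ʰ are each 1-Lipschitz in h ≥ 0, whence the factor 2. -/
theorem Real.mul_add_exp_neg_sub_le {p δ h : ℝ} (hp : 0 ≤ p) (hp1 : p ≤ 1) (hδ : 0 < δ)
    (hh : 0 ≤ h) :
    p * h + Real.exp (-h) - p ≤ Real.negMulLog p + δ + 2 * |-Real.log (max δ p) - h| := by
  set H := -Real.log (max δ p) with hH
  have hmax : 0 < max δ p := hδ.trans_le (le_max_left _ _)
  have h1 : p * h ≤ p * H + |H - h| := by
    have := mul_le_mul_of_nonneg_left (neg_abs_le (H - h)) hp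
    nlinarith [abs_nonneg (H - h)]
  have h2 : Real.exp (-h) ≤ Real.exp (-H) + |H - h| := by
    have h3 : Real.exp (-H) = Real.exp (-h) * Real.exp (-(H - h)) := by
      rw [← Real.exp_add]
      ring_nf
    have h4 : Real.exp (-h) ≤ 1 := Real.exp_le_one_iff.2 (by linarith)
    have h5 := mul_le_mul_of_nonneg_left (Real.add_one_le_exp (-(H - h))) (Real.exp_pos (-h)).le
    have h6 := mul_le_mul_of_nonneg_left (le_abs_self (H - h)) (Real.exp_pos (-h)).le
    have h7 := mul_le_mul_of_nonneg_right h4 (abs_nonneg (H - h))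
    nlinarith
  have h3 : Real.exp (-H) ≤ δ + p := by
    rw [hH, neg_neg, Real.exp_log hmax]
    exact max_le_add_of_nonneg hδ.le hp
  have h4 : p * H ≤ Real.negMulLog p := by
    rw [Real.negMulLog, neg_mul, hH, mul_neg, neg_le_neg_iff]
    rcases hp.eq_or_lt with rfl | hp
    · simp
    · exact mul_le_mul_of_nonneg_left (Real.log_le_log hp (le_max_right _ _)) hp.le
  linarith

section Variational

variable {Ω : Type*} {m m₀ : MeasurableSpace Ω} {μ : Measure Ω} {Z : Type*}

theorem integral_indicator_mul_eq [IsFiniteMeasure μ] (hm : m ≤ m₀)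
    {A : Set Ω} (hA : MeasurableSet A) {g : Ω → ℝ} (hg : StronglyMeasurable[m] g)
    (hgi : Integrable g μ) :
    ∫ ω, A.indicator (fun _ => (1 : ℝ)) ω * g ω ∂μ = ∫ ω, condProbability m μ A ω * g ω ∂μ := by
  have hint : Integrable ((A.indicator fun _ => (1 : ℝ)) * g) μ := by
    have : (A.indicator fun _ => (1 : ℝ)) * g = A.indicator g := by
      ext ω
      by_cases h : ω ∈ A <;> simp [h]
    rw [this]
    exact hgi.indicator hA
  have h := condExp_mul_of_stronglyMeasurable_right hg hint (integrable_indicator_one hA)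
  have h2 := integral_condExp (μ := μ) (f := (A.indicator fun _ => (1 : ℝ)) * g) hm
  exact h2.symm.trans (integral_congr_ae h)

variable [MetricSpace Z] [MeasurableSpace Z] [BorelSpace Z]

/-- As h(T) is measurable for the conditioning, the conditional probability may be replaced by the
indicator of A, leaving an integrand that does not depend on μ. -/
theorem integral_gibbs_eq [IsFiniteMeasure μ] {T : Ω → Z} (hT : Measurable T) {A : Set Ω}
    (hA : MeasurableSet A) {h : BoundedContinuousFunction Z ℝ} (h0 : 0 ≤ h) :
    Integrable (fun ω => condProbability (MeasurableSpace.comap T inferInstance) μ A ω * h (T ω) +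
        Real.exp (-h (T ω)) - condProbability (MeasurableSpace.comap T inferInstance) μ A ω) μ ∧
      ∫ ω, (A.indicator (fun _ => (1 : ℝ)) ω * h (T ω) + Real.exp (-h (T ω)) -
        A.indicator (fun _ => (1 : ℝ)) ω) ∂μ =
      ∫ ω, (condProbability (MeasurableSpace.comap T inferInstance) μ A ω * h (T ω) +
        Real.exp (-h (T ω)) - condProbability (MeasurableSpace.comap T inferInstance) μ A ω) ∂μ := by
  have hg : StronglyMeasurable[MeasurableSpace.comap T inferInstance] fun ω => h (T ω) :=
    (h.continuous.measurable.comp (comap_measurable T)).stronglyMeasurable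
  have hgm := (h.continuous.measurable.comp hT).aestronglyMeasurable (μ := μ)
  have hgi : Integrable (fun ω => h (T ω)) μ :=
    .of_bound hgm ‖h‖ (Eventually.of_forall fun ω => h.norm_coe_le_norm _)
  have hexp : Integrable (fun ω => Real.exp (-h (T ω))) μ := by
    refine .of_bound (Real.continuous_exp.comp_aestronglyMeasurable hgm.neg) 1
      (Eventually.of_forall fun ω => ?_)
    rw [Real.norm_of_nonneg (Real.exp_pos _).le, Real.exp_le_one_iff]
    exact neg_nonpos.2 (h0 (T ω))
  have hb : ∀ᵐ ω ∂μ, ‖h (T ω)‖ ≤ ‖h‖ := Eventually.of_forall fun ω => h.norm_coe_le_norm _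
  have key : ∀ {f k : Ω → ℝ}, Integrable f μ → Integrable k μ →
      ∫ ω, (f ω + Real.exp (-h (T ω)) - k ω) ∂μ =
        ∫ ω, f ω ∂μ + ∫ ω, Real.exp (-h (T ω)) ∂μ - ∫ ω, k ω ∂μ := fun {f k} hf hk => by
    have hfe : Integrable (fun ω => f ω + Real.exp (-h (T ω))) μ := hf.add hexp
    rw [integral_sub hfe hk, integral_add hf hexp]
  have h1 : Integrable (fun ω => A.indicator (fun _ => (1 : ℝ)) ω * h (T ω)) μ :=
    (integrable_indicator_one hA).mul_bdd (c := ‖h‖) hgm hb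
  have h2 : Integrable (fun ω =>
      condProbability (MeasurableSpace.comap T inferInstance) μ A ω * h (T ω)) μ := (integrable_condProbability (m := MeasurableSpace.comap T inferInstance)
    (μ := μ) A).mul_bdd (c := ‖h‖) hgm hb
  refine ⟨(h2.add hexp).sub (integrable_condProbability A), ?_⟩
  rw [key h1 (integrable_indicator_one hA), key h2 (integrable_condProbability A), integral_indicator_mul_eq hT.comap_le hA hg hgi,
    ← integral_condExp (f := A.indicator _) hT.comap_le]
  rfl

theorem integral_negMulLog_condProbability_le [IsFiniteMeasure μ] {T : Ω → Z} (hT : Measurable T)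
    {A : Set Ω} (hA : MeasurableSet A) {h : BoundedContinuousFunction Z ℝ} (h0 : 0 ≤ h) :
    ∫ ω, Real.negMulLog (condProbability (MeasurableSpace.comap T inferInstance) μ A ω) ∂μ ≤
      ∫ ω, (A.indicator (fun _ => (1 : ℝ)) ω * h (T ω) + Real.exp (-h (T ω)) -
        A.indicator (fun _ => (1 : ℝ)) ω) ∂μ := by
  obtain ⟨hi, he⟩ := integral_gibbs_eq (μ := μ) hT hA h0
  rw [he]
  refine integral_mono_ae (integrable_negMulLog_condProbability hT.comap_le hA) hi ?_
  filter_upwards [condProbability_nonneg (m := MeasurableSpace.comap T inferInstance) (μ := μ) A]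
    with ω hω using Real.negMulLog_le_mul_add_exp_neg_sub hω _

theorem exists_integral_gibbs_lt [IsProbabilityMeasure μ] {T : Ω → Z} (hT : Measurable T)
    {A : Set Ω} (hA : MeasurableSet A) {y : ℝ}
    (hy : ∫ ω, Real.negMulLog (condProbability (MeasurableSpace.comap T inferInstance) μ A ω) ∂μ
      < y) :
    ∃ h : BoundedContinuousFunction Z ℝ, 0 ≤ h ∧
      ∫ ω, (A.indicator (fun _ => (1 : ℝ)) ω * h (T ω) + Real.exp (-h (T ω)) -
        A.indicator (fun _ => (1 : ℝ)) ω) ∂μ < y := by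
  set e := condProbability (MeasurableSpace.comap T inferInstance) μ A
  obtain ⟨δ, hδ0, hδ1, hδ⟩ : ∃ δ : ℝ, 0 < δ ∧ δ ≤ 1 ∧
      ∫ ω, Real.negMulLog (e ω) ∂μ + 3 * δ < y := by
    -- Of the 3δ, one δ pays for the truncation and two for the L¹ approximation.
    refine ⟨min 1 ((y - ∫ ω, Real.negMulLog (e ω) ∂μ) / 4), lt_min one_pos (by linarith),
      min_le_left _ _, ?_⟩
    linarith [min_le_right 1 ((y - ∫ ω, Real.negMulLog (e ω) ∂μ) / 4)]
  obtain ⟨p, hp, hpe⟩ := (stronglyMeasurable_condProbability (μ := μ)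
    (m := MeasurableSpace.comap T inferInstance) A).measurable.exists_eq_measurable_comp
  -- The cap at 1 makes H bounded and nonnegative everywhere, since p(T) ≤ 1 is only known almost
  -- everywhere.
  let H (z : Z) : ℝ := -Real.log (max δ (min 1 (p z)))
  have hH : Measurable H :=
    (Real.measurable_log.comp (measurable_const.max (measurable_const.min hp))).neg
  have hprob : IsProbabilityMeasure (μ.map T) := Measure.isProbabilityMeasure_map hT.aemeasurable
  have hHi : Integrable H (μ.map T) := by
    refine .of_bound hH.aestronglyMeasurable (-Real.log δ)
      (Eventually.of_forall fun z => ?_)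
    have h1 : Real.log δ ≤ Real.log (max δ (min 1 (p z))) :=
      Real.log_le_log hδ0 (le_max_left _ _)
    have h2 : Real.log (max δ (min 1 (p z))) ≤ 0 :=
      Real.log_nonpos (hδ0.le.trans (le_max_left _ _)) (max_le hδ1 (min_le_left _ _))
    rw [Real.norm_of_nonneg (neg_nonneg.2 h2)]
    exact neg_le_neg h1
  obtain ⟨h', hh', -⟩ := hHi.exists_boundedContinuous_integral_sub_le hδ0
  -- The L¹ approximant may be negative; clipping it at 0 moves it no further from H, which is
  -- nonnegative on the range of T almost surely.
  refine ⟨h' ⊔ 0, le_sup_right, ?_⟩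
  set h := h' ⊔ 0
  have h0 : 0 ≤ h := le_sup_right
  obtain ⟨hi, hJ⟩ := integral_gibbs_eq (μ := μ) hT hA h0
  have hdi : Integrable (fun z => |H z - h' z|) (μ.map T) :=
    (hHi.sub (h'.integrable _)).abs
  have hdT : Integrable (fun ω => |H (T ω) - h' (T ω)|) μ := hdi.comp_measurable hT
  have hφ : Integrable (fun ω => Real.negMulLog (e ω)) μ :=
    integrable_negMulLog_condProbability hT.comap_le hA
  simp only [Real.norm_eq_abs] at hh'
  rw [integral_map hT.aemeasurable hdi.aestronglyMeasurable] at hh'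
  rw [hJ]
  calc ∫ ω, (e ω * h (T ω) + Real.exp (-h (T ω)) - e ω) ∂μ
      ≤ ∫ ω, (Real.negMulLog (e ω) + δ + 2 * |H (T ω) - h' (T ω)|) ∂μ := by
        refine integral_mono_ae hi ((hφ.add (integrable_const δ)).add (hdT.const_mul 2)) ?_
        filter_upwards [condProbability_nonneg (m := MeasurableSpace.comap T inferInstance)
          (μ := μ) A, condProbability_le_one (μ := μ) hT.comap_le hA] with ω he0 he1
        have hpω : p (T ω) = e ω := (congrFun hpe ω).symm
        have hHω : H (T ω) = -Real.log (max δ (e ω)) := by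
          simp only [H, hpω]
          rw [min_eq_right he1]
        have hle := Real.mul_add_exp_neg_sub_le (p := e ω) (h := h (T ω)) he0 he1 hδ0 (h0 (T ω))
        have hmax : 0 ≤ H (T ω) := by
          rw [hHω, neg_nonneg]
          exact Real.log_nonpos (hδ0.le.trans (le_max_left _ _)) (max_le hδ1 he1)
        have habs : |H (T ω) - h (T ω)| ≤ |H (T ω) - h' (T ω)| := by
          have : h (T ω) = max (h' (T ω)) 0 := rfl
          rw [this]
          rcases le_total 0 (h' (T ω)) with h1 | h1
          · rw [max_eq_left h1]
          · rw [max_eq_right h1, abs_of_nonneg (by linarith), abs_of_nonneg (by linarith)]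
            linarith
        rw [hHω] at habs ⊢
        linarith
    _ = ∫ ω, Real.negMulLog (e ω) ∂μ + δ + 2 * ∫ ω, |H (T ω) - h' (T ω)| ∂μ := by
        have hφδ : Integrable (fun ω => Real.negMulLog (e ω) + δ) μ := hφ.add (integrable_const δ)
        rw [integral_add hφδ (hdT.const_mul 2),
          integral_add hφ (integrable_const δ), integral_const_mul]
        simp
    _ < y := by
        have : ∫ ω, |H (T ω) - h' (T ω)| ∂μ ≤ δ := hh'
        linarith

variable [TopologicalSpace Ω] [OpensMeasurableSpace Ω]

theorem upperSemicontinuous_integral_negMulLog_condProbability {T : Ω → Z} (hT : Continuous T)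
    {A : Set Ω} (hA : IsClopen A) :
    UpperSemicontinuous fun m : ProbabilityMeasure Ω => ∫ ω, Real.negMulLog
      (condProbability (MeasurableSpace.comap T inferInstance) (m : Measure Ω) A ω)
      ∂(m : Measure Ω) := by
  intro m y hy
  obtain ⟨h, h0, hlt⟩ := exists_integral_gibbs_lt hT.measurable hA.isOpen.measurableSet hy
  -- A near-optimal test function for m gives a weak-star continuous upper bound at all nearby
  -- measures; A being clopen makes its integrand continuous.
  have hcont : Continuous fun ω => A.indicator (fun _ => (1 : ℝ)) ω * h (T ω) +
      Real.exp (-h (T ω)) - A.indicator (fun _ => (1 : ℝ)) ω := by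
    have h1 : Continuous (A.indicator fun _ => (1 : ℝ)) := hA.continuous_indicator continuous_const
    fun_prop
  let g : BoundedContinuousFunction Ω ℝ := .ofNormedAddCommGroup _ hcont (‖h‖ + 1 + 1) fun ω => by
    have h1 : ‖h (T ω)‖ ≤ ‖h‖ := h.norm_coe_le_norm _
    have h2 : Real.exp (-h (T ω)) ≤ 1 := Real.exp_le_one_iff.2 (neg_nonpos.2 (h0 (T ω)))
    have h3 := Real.exp_pos (-h (T ω))
    have h4 : 0 ≤ h (T ω) := h0 (T ω)
    rw [Real.norm_of_nonneg h4] at h1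
    rw [Real.norm_eq_abs, abs_le]
    by_cases hω : ω ∈ A <;> simp only [hω, Set.indicator_of_mem, Set.indicator_of_notMem,
      not_false_eq_true] <;> constructor <;> linarith
  have hc := ((ProbabilityMeasure.continuous_integral_boundedContinuousFunction g).tendsto
    m).eventually (gt_mem_nhds hlt)
  filter_upwards [hc] with m' hm'
  exact (integral_negMulLog_condProbability_le hT.measurable hA.isOpen.measurableSet h0).trans_lt hm'

end Variational

/-! ### Equivariance of the coding map and recovery of points by injectivity. -/

namespace IFS

variable {d ℓ : ℕ}

theorem wordMap_injective (Φ : IFS d ℓ) (hinj : ∀ i, Function.Injective (Φ.map i)) (n : ℕ)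
    (u : Fin n → Fin ℓ) : Function.Injective (Φ.wordMap n u) := by
  induction n with
  | zero => exact Function.injective_id
  | succ n ih => exact (hinj _).comp (ih _)

theorem continuous_wordMap (Φ : IFS d ℓ) (n : ℕ) (u : Fin n → Fin ℓ) :
    Continuous (Φ.wordMap n u) := by
  obtain ⟨c, -, hc⟩ := Φ.exists_ratio
  exact (Φ.lipschitzWith_wordMap hc n u).continuous

/-- By the Lusin–Souslin theorem, a continuous injection of the Polish space X is a measurable
embedding, so its inverse has a Borel extension to all of ℝ^d. -/
theorem exists_measurable_eq_wordMap (Φ : IFS d ℓ) (hinj : ∀ i, Function.Injective (Φ.map i))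
    (n : ℕ) (u : Fin n → Fin ℓ) :
    ∃ R R' : EuclideanSpace ℝ (Fin d) → EuclideanSpace ℝ (Fin d), Measurable R ∧ Measurable R' ∧
      ∀ p : Φ.X, (p : EuclideanSpace ℝ (Fin d)) = R (Φ.wordMap n u p) ∧
        (Φ.wordMap n u p : EuclideanSpace ℝ (Fin d)) = R' p := by
  have : PolishSpace Φ.X := Φ.isClosed_X.polishSpace
  have hval : MeasurableEmbedding ((↑) : Φ.X → EuclideanSpace ℝ (Fin d)) :=
    .subtype_coe Φ.isClosed_X.measurableSet
  have hf : MeasurableEmbedding (Φ.wordMap n u) :=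
    (Φ.continuous_wordMap n u).measurableEmbedding (Φ.wordMap_injective hinj n u)
  obtain ⟨R, hR, hRe⟩ := (hval.comp hf).exists_measurable_extend hval.measurable fun _ => ⟨0⟩
  obtain ⟨R', hR', hRe'⟩ :=
    hval.exists_measurable_extend (hval.comp hf).measurable fun _ => ⟨0⟩
  exact ⟨R, R', hR, hR', fun p => ⟨(congrFun hRe p).symm, (congrFun hRe' p).symm⟩⟩

variable [NeZero ℓ]

theorem proj_eq_of_forall_mem (Φ : IFS d ℓ) {x : ℕ → Fin ℓ} {p : Φ.X}
    (hp : ∀ n : ℕ, p ∈ Φ.wordMap n (fun i => x i) '' Φ.attractor) : Φ.proj x = p := by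
  have : (p : EuclideanSpace ℝ (Fin d)) ∈ ({Φ.proj x} : Set _) := by
    rw [← iInter_eq_singleton_proj]
    exact Set.mem_iInter.2 fun n => Set.mem_image_of_mem _ (hp n)
  exact (Set.mem_singleton_iff.1 this).symm

theorem exists_coe_eq_proj (Φ : IFS d ℓ) (x : ℕ → Fin ℓ) :
    ∃ p : Φ.X, Φ.proj x = p ∧ ∀ n : ℕ, p ∈ Φ.wordMap n (fun i => x i) '' Φ.attractor := by
  obtain ⟨p, hp⟩ := Φ.exists_iInter_eq_singleton x
  have h : ∀ n : ℕ, p ∈ Φ.wordMap n (fun i => x i) '' Φ.attractor :=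
    Set.mem_iInter.1 (hp.symm ▸ Set.mem_singleton p)
  exact ⟨p, Φ.proj_eq_of_forall_mem h, h⟩

theorem map_image_attractor_subset (Φ : IFS d ℓ) (i : Fin ℓ) :
    Φ.map i '' Φ.attractor ⊆ Φ.attractor := by
  conv_rhs => rw [Φ.isAttractor_attractor.2.2]
  exact Set.subset_iUnion (fun i => Φ.map i '' Φ.attractor) i

theorem exists_proj_eq_wordMap (Φ : IFS d ℓ) (n : ℕ) (x : ℕ → Fin ℓ) :
    ∃ p : Φ.X, Φ.proj (shift^[n] x) = p ∧ Φ.proj x = Φ.wordMap n (fun i => x i) p := by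
  induction n generalizing x with
  | zero =>
    obtain ⟨p, hp, -⟩ := Φ.exists_coe_eq_proj x
    exact ⟨p, hp, hp⟩
  | succ n ih =>
    obtain ⟨p, hp, hxp⟩ := ih (shift x)
    obtain ⟨q, hq, hqn⟩ := Φ.exists_coe_eq_proj (shift x)
    refine ⟨p, hp, ?_⟩
    have hqp : q = Φ.wordMap n (fun i => shift x i) p := Subtype.ext (hq.symm.trans hxp)
    -- The image of q under the first map lies in every cylinder of x, since q lies in every
    -- cylinder of the shifted sequence.
    have key : Φ.proj x = Φ.map (x 0) q := by
      refine Φ.proj_eq_of_forall_mem fun k => ?_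
      cases k with
      | zero =>
        have := hqn 0
        simp only [wordMap, Set.image_id] at this ⊢
        exact Φ.map_image_attractor_subset _ ⟨q, this, rfl⟩
      | succ k =>
        rw [wordMap, Set.image_comp]
        exact ⟨q, hqn k, rfl⟩
    rw [key, hqp]
    rfl

theorem proj_mem_image_attractor (Φ : IFS d ℓ) (n : ℕ) (x : ℕ → Fin ℓ) :
    Φ.proj x ∈ ((↑) : Φ.X → EuclideanSpace ℝ (Fin d)) ''
      (Φ.wordMap n (fun i => x i) '' Φ.attractor) := by
  obtain ⟨p, hp, hpn⟩ := Φ.exists_coe_eq_proj x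
  exact ⟨p, hpn n, hp.symm⟩

/-- The relation π x = S_{x|n}(π(σⁿx)) involves the word only through its map; hence words with
equal maps can be merged. -/
theorem exists_measurable_proj_shift (Φ : IFS d ℓ) (hinj : ∀ i, Function.Injective (Φ.map i))
    (n : ℕ) (u : Fin n → Fin ℓ) :
    ∃ R R' : EuclideanSpace ℝ (Fin d) → EuclideanSpace ℝ (Fin d), Measurable R ∧ Measurable R' ∧
      ∀ x, Φ.wordMap n (fun i => x i) = Φ.wordMap n u →
        Φ.proj (shift^[n] x) = R (Φ.proj x) ∧ Φ.proj x = R' (Φ.proj (shift^[n] x)) := by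
  obtain ⟨R, R', hR, hR', h⟩ := Φ.exists_measurable_eq_wordMap hinj n u
  refine ⟨R, R', hR, hR', fun x hx => ?_⟩
  obtain ⟨p, hp, hxp⟩ := Φ.exists_proj_eq_wordMap n x
  rw [hp, hxp, hx]
  exact h p

end IFS

/-! ### The shift and initial words. -/

section Shift

variable {ℓ : ℕ}

theorem continuous_shift : Continuous (shift : (ℕ → Fin ℓ) → ℕ → Fin ℓ) :=
  continuous_pi fun n => continuous_apply (n + 1)

theorem iterate_shift_apply (k : ℕ) (x : ℕ → Fin ℓ) (i : ℕ) : shift^[k] x i = x (i + k) := by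
  induction k generalizing x with
  | zero => rfl
  | succ k ih =>
    rw [Function.iterate_succ_apply, ih]
    exact congrArg x (by ring)

/-- The initial word of length `n` of a sequence. -/
def initialWord (n : ℕ) (x : ℕ → Fin ℓ) : Fin n → Fin ℓ := fun i => x i

theorem continuous_initialWord (n : ℕ) : Continuous (initialWord n : (ℕ → Fin ℓ) → _) :=
  continuous_pi fun i => continuous_apply (i : ℕ)

theorem isClopen_preimage_initialWord (n : ℕ) (s : Set (Fin n → Fin ℓ)) :
    IsClopen (initialWord n ⁻¹' s) :=
  (isClopen_discrete s).preimage (continuous_initialWord n)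

theorem measurableSet_firstSymbol (j : Fin ℓ) : MeasurableSet (firstSymbol j) :=
  measurableSet_preimage (measurable_pi_apply (X := fun _ : ℕ => Fin ℓ) 0)
    (measurableSet_singleton j)

end Shift

/-! ### The n-step entropy formula and the proof of semicontinuity. -/

namespace IFS

variable {d ℓ : ℕ}

/-- The map `S_{x_1} ∘ ⋯ ∘ S_{x_n}` as a function of the sequence `x`. -/
def wordMapClass (Φ : IFS d ℓ) (n : ℕ) (u : Fin n → Fin ℓ) : Set.range (Φ.wordMap n) :=
  ⟨Φ.wordMap n u, u, rfl⟩

noncomputable instance (Φ : IFS d ℓ) (n : ℕ) : Fintype (Set.range (Φ.wordMap n)) :=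
  Fintype.ofFinite _

/-- The partition of the symbolic space according to the map `S_{x_1} ∘ ⋯ ∘ S_{x_n}`. -/
def wordMapPartition (Φ : IFS d ℓ) (n : ℕ) (f : Set.range (Φ.wordMap n)) : Set (ℕ → Fin ℓ) :=
  (Φ.wordMapClass n ∘ initialWord n) ⁻¹' {f}

theorem isClopen_wordMapPartition (Φ : IFS d ℓ) (n : ℕ) (f : Set.range (Φ.wordMap n)) :
    IsClopen (Φ.wordMapPartition n f) :=
  isClopen_preimage_initialWord n (Φ.wordMapClass n ⁻¹' {f})

variable [NeZero ℓ]

theorem continuous_proj_iterate_shift (Φ : IFS d ℓ) (k : ℕ) :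
    Continuous (Φ.proj ∘ shift^[k]) :=
  Φ.continuous_proj.comp (continuous_shift.iterate k)

theorem projEntropy_eq (Φ : IFS d ℓ) (m : Measure (ℕ → Fin ℓ)) :
    Φ.projEntropy m =
      condEntropy (MeasurableSpace.comap (Φ.proj ∘ shift^[1]) inferInstance) m firstSymbol -
        condEntropy (MeasurableSpace.comap (Φ.proj ∘ shift^[0]) inferInstance) m firstSymbol := by
  rw [projEntropy, MeasurableSpace.comap_comp,
    ← BorelSpace.measurable_eq (α := EuclideanSpace ℝ (Fin d))]
  rfl

theorem nsmul_projEntropy_eq (Φ : IFS d ℓ) (hinj : ∀ i, Function.Injective (Φ.map i))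
    {m : Measure (ℕ → Fin ℓ)} [IsFiniteMeasure m] (hm : MeasurePreserving shift m m) (n : ℕ) :
    n * Φ.projEntropy m =
      condEntropy (MeasurableSpace.comap (Φ.proj ∘ shift^[n]) inferInstance) m
          (Φ.wordMapPartition n) -
        condEntropy (MeasurableSpace.comap Φ.proj inferInstance) m (Φ.wordMapPartition n) := by
  let a (k : ℕ) : ℝ := condEntropy (MeasurableSpace.comap (Φ.proj ∘ shift^[k]) inferInstance) m
    fun u : Fin n → Fin ℓ => initialWord n ⁻¹' {u}
  have hT := fun k => (Φ.continuous_proj_iterate_shift k).measurable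
  have hX : ∀ u : Fin n → Fin ℓ, MeasurableSet (initialWord n ⁻¹' {u}) := fun u =>
    (isClopen_preimage_initialWord n {u}).isOpen.measurableSet
  -- Given the letter at position k, π(σᵏx) and π(σᵏ⁺¹x) determine each other, so the increment is
  -- already that of the one-letter partition; invariance under σᵏ identifies it with h_π.
  have hstep : ∀ k < n, a (k + 1) - a k = Φ.projEntropy m := fun k hk => by
    have h := condEntropy_comap_sub_comap (μ := m) (hT (k + 1)) (hT k) hX
      (fun u => u ⟨k, hk⟩) fun j => by
        obtain ⟨R, R', hR, hR', h⟩ := Φ.exists_measurable_proj_shift hinj 1 fun _ => j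
        refine ⟨R, R', hR, hR', fun x hx => ?_⟩
        have := h (shift^[k] x) (congrArg _ (funext fun i => ?_))
        · rwa [← Function.iterate_add_apply, add_comm] at this
        · rw [Subsingleton.elim i 0, iterate_shift_apply]
          simpa [initialWord] using hx
    have hset : (fun j : Fin ℓ => ((fun u : Fin n → Fin ℓ => u ⟨k, hk⟩) ∘ initialWord n) ⁻¹' {j}) =
        fun j => shift^[k] ⁻¹' firstSymbol j := by
      ext j x
      simp [initialWord, firstSymbol, iterate_shift_apply]
    have hcomp : Φ.proj ∘ shift^[k + 1] = (Φ.proj ∘ shift^[1]) ∘ shift^[k] := by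
      rw [Function.comp_assoc, ← Function.iterate_add, add_comm]
    rw [hset, hcomp, condEntropy_comap_comp (hm.iterate k) (hT 1) measurableSet_firstSymbol,
      condEntropy_comap_comp (hm.iterate k) (Φ.continuous_proj.measurable)
        measurableSet_firstSymbol] at h
    rw [← hcomp] at h
    rw [projEntropy_eq]
    exact h
  have hsum : n * Φ.projEntropy m = a n - a 0 := by
    rw [← Finset.sum_range_sub, Finset.sum_congr rfl fun k hk => hstep k (Finset.mem_range.1 hk)]
    simp
  rw [hsum]
  -- The same principle, now with the coarsening of words to their maps.
  refine condEntropy_comap_sub_comap (μ := m) (hT n) (hT 0) hX (Φ.wordMapClass n) ?_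
  rintro ⟨_, u, rfl⟩
  obtain ⟨R, R', hR, hR', h⟩ := Φ.exists_measurable_proj_shift hinj n u
  exact ⟨R, R', hR, hR', fun x hx => h x (congrArg Subtype.val hx)⟩

theorem condEntropy_wordMapPartition_le (Φ : IFS d ℓ) (m : Measure (ℕ → Fin ℓ))
    [IsProbabilityMeasure m] (n : ℕ) :
    condEntropy (MeasurableSpace.comap Φ.proj inferInstance) m (Φ.wordMapPartition n) ≤
      Real.log (Φ.overlapCount n) := by
  refine condEntropy_le_log Φ.continuous_proj.measurable.comap_le
    (fun f => (Φ.isClopen_wordMapPartition n f).isOpen.measurableSet)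
    -- The maps f compatible with a known π x are those with π x in f(K); `overlapCount` bounds
    -- their number.
    (C := fun f => Φ.proj ⁻¹' (((↑) : Φ.X → EuclideanSpace ℝ (Fin d)) '' (f.1 '' Φ.attractor)))
    (fun f => ?_) (fun f x hx => ?_) fun x => ?_
  · obtain ⟨_, u, rfl⟩ := f
    exact ⟨_, ((Φ.isAttractor_attractor.2.1.image (Φ.continuous_wordMap n u)).image
      continuous_subtype_val).isClosed.measurableSet, rfl⟩
  · have : Φ.wordMap n (fun i => x i) = f.1 := congrArg Subtype.val hx
    rw [← this]
    exact Φ.proj_mem_image_attractor n x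
  · refine le_trans ?_ (le_ciSup (Φ.bddAbove_overlapCount n) (Φ.proj x))
    refine Set.ncard_le_ncard_of_injOn Subtype.val ?_ Subtype.val_injective.injOn ?_
    · rintro ⟨_, u, rfl⟩ h
      exact ⟨u, rfl, h⟩
    · refine (Set.finite_range (Φ.wordMap n)).subset ?_
      rintro f ⟨u, rfl, -⟩
      exact ⟨u, rfl⟩

theorem upperSemicontinuous_condEntropy_wordMapPartition (Φ : IFS d ℓ) (n : ℕ) :
    UpperSemicontinuous fun m : InvMeasure ℓ =>
      condEntropy (MeasurableSpace.comap (Φ.proj ∘ shift^[n]) inferInstance)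
        (m.1 : Measure (ℕ → Fin ℓ)) (Φ.wordMapPartition n) := by
  have h : UpperSemicontinuous fun m : ProbabilityMeasure (ℕ → Fin ℓ) =>
      ∑ f : Set.range (Φ.wordMap n), ∫ ω, Real.negMulLog (condProbability
        (MeasurableSpace.comap (Φ.proj ∘ shift^[n]) inferInstance) (m : Measure (ℕ → Fin ℓ))
        (Φ.wordMapPartition n f) ω) ∂(m : Measure (ℕ → Fin ℓ)) :=
    upperSemicontinuous_sum fun f _ => upperSemicontinuous_integral_negMulLog_condProbability
      (Φ.continuous_proj_iterate_shift n) (Φ.isClopen_wordMapPartition n f)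
  convert h.comp (continuous_subtype_val (p := fun m : ProbabilityMeasure (ℕ → Fin ℓ) =>
    MeasurePreserving shift (m : Measure (ℕ → Fin ℓ)) m)) using 2 with m
  exact condEntropy_eq_sum_integral_negMulLog
    (Φ.continuous_proj_iterate_shift n).measurable.comap_le
    fun f => (Φ.isClopen_wordMapPartition n f).isOpen.measurableSet

end IFS

theorem mainTheorem9 {d ℓ : ℕ} [NeZero ℓ] (Φ : IFS d ℓ)
    (hinj : ∀ i, Function.Injective (Φ.map i)) (hΦ : Φ.AWSC) :
    UpperSemicontinuous
      (fun m : InvMeasure ℓ => Φ.projEntropy (m.1 : Measure (ℕ → Fin ℓ))) := by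
  intro m y hy
  -- One n suffices: the loss (log t_n)/n has to fit in the gap between y and the value at m.
  obtain ⟨n, hn0, hn⟩ : ∃ n : ℕ, 0 < n ∧
      1 / (n : ℝ) * Real.log (Φ.overlapCount n) < y - Φ.projEntropy (m.1 : Measure (ℕ → Fin ℓ)) :=
    ((eventually_gt_atTop 0).and (hΦ.eventually (gt_mem_nhds (sub_pos.2 hy)))).exists
  have hn' : (0 : ℝ) < n := by exact_mod_cast hn0
  have hF : condEntropy (MeasurableSpace.comap (Φ.proj ∘ shift^[n]) inferInstance)
      (m.1 : Measure (ℕ → Fin ℓ)) (Φ.wordMapPartition n) < n * y := by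
    have h1 := Φ.nsmul_projEntropy_eq hinj m.2 n
    have h2 := Φ.condEntropy_wordMapPartition_le (m.1 : Measure (ℕ → Fin ℓ)) n
    rw [one_div, inv_mul_lt_iff₀ hn'] at hn
    linarith
  -- At nearby measures the subtracted entropy is simply dropped, being nonnegative; its bound by
  -- log t_n was needed only at m.
  filter_upwards [Φ.upperSemicontinuous_condEntropy_wordMapPartition n m _ hF] with m' hm'
  have h1 := Φ.nsmul_projEntropy_eq hinj m'.2 n
  have h2 : 0 ≤ condEntropy (MeasurableSpace.comap Φ.proj inferInstance)
      (m'.1 : Measure (ℕ → Fin ℓ)) (Φ.wordMapPartition n) :=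
    condEntropy_nonneg Φ.continuous_proj.measurable.comap_le
      fun f => (Φ.isClopen_wordMapPartition n f).isOpen.measurableSet
  exact lt_of_mul_lt_mul_left (by linarith) hn'.le
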